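/- Let $\mathbb F_2 = SU(3)/T^2$ be the manifold of full flags in $\mathbb C^3$, where $T^2$ is the torus of diagonal matrices with Lie algebra $\mathfrak t$, and write the Maurer–Cartan form of $SU(3)$ as $$g^{-1}dg = \begin{pmatrix} i\beta_1 & \theta_3+i\eta_3 & -\theta_2+i\eta_2\\ -\theta_3+i\eta_3 & i\beta_2 & \theta_1+i\eta_1\\ \theta_2+i\eta_2 & -\theta_1+i\eta_1 & i\beta_3\end{pmatrix}.$$ For $A_1,A_2,A_3>0$ and $\varepsilon_1,\varepsilon_2,\varepsilon_3\in\{\pm1\}$ equip $\mathbb F_2$ with the $SU(3)$-invariant almost Hermitian structure whose $(1,0)$-forms are spanned by $\alpha_j = A_j(\eta_j+i\varepsilon_j\theta_j)$, $j=1,2,3$, and whose fundamental form is $\omega=\frac i2\sum_j\alpha_j\wedge\bar\alpha_j$; orient $\mathbb F_2$ by $\omega^3/3!$, which is the volume form of the metric. Let $\beta\in\mathfrak t^*$ be an integral weight, extended to a left-invariant $1$-form on $SU(3)$ by zero on the Killing-orthogonal complement of $\mathfrak t$, and let $L_\beta = SU(3)\times_{(T^2,e^{i\beta})}\mathbb C$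 be the associated homogeneous Hermitian line bundle. Unitary connections on $L_\beta$ are identified with $i\mathbb R$-valued $1$-forms $a$ on $SU(3)$ (covariant derivative $d+a$ on sections viewed as equivariant functions, curvature $F=da$). Put $$\deg(L_\beta)=2\pi\,\langle c_1(L_\beta)\cup[\omega^2],[\mathbb F_2]\rangle = 2\pi\int_{\mathbb F_2}\tfrac{i}{2\pi}F\wedge\omega^2,\qquad \mu(L_\beta)=\frac{\deg(L_\beta)}{\mathrm{Vol}(\mathbb F_2)},$$ where $F$ is the curvature of any unitary connection on $L_\beta$ (the value does not depend on the choice). A connection is called pseudo-holomorphic if $F$ is of type $(1,1)$, and pHYM of degree $0$ if moreover $\Lambda F=*(F\wedge\omega^2)=0$. Then: 1. $i\beta$ is an $SU(3)$-invariant unitary connection on $L_\beta$, and it is the only one. 2. The connection $i\beta$ is pseudo-holomorphic. 3. The connection $i\beta$ is pHYM of degree $0$ if and only if $\mu(L_\beta)=0$. 4. If $\beta=k\beta_1+l\beta_2$ on $\mathfrak t$ with $k,l\in\mathbb Z$, then $\mu(L_\beta)=0$ if and only if $$k\,\varepsilon_1A_1^2\,(A_2^2\varepsilon_2-A_3^2\varepsilon_3)=l\,\varepsilon_2A_2^2\,(A_1^2\varepsilon_1-A_3^2\varepsilon_3).$$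 -/

import Mathlib

open Matrix MeasureTheory
open scoped ContDiff

namespace FlagPHYM

noncomputable section

/-! ## The group `SU(3)` and its Lie algebra -/

/-- The group `SU(3)`. -/
abbrev SU3 := Matrix.specialUnitaryGroup (Fin 3) ℂ

/-- The Lie algebra `𝔰𝔲(3)` of traceless skew-Hermitian matrices. -/
def su3 : Submodule ℝ (Matrix (Fin 3) (Fin 3) ℂ) where
  carrier := {X | Xᴴ = -X ∧ X.trace = 0}
  add_mem' := by
    rintro X Y ⟨hX, hX'⟩ ⟨hY, hY'⟩
    exact ⟨by rw [conjTranspose_add, hX, hY]; abel, by rw [trace_add, hX', hY', add_zero]⟩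
  zero_mem' := ⟨by simp, by simp⟩
  smul_mem' := by
    rintro c X ⟨hX, hX'⟩
    exact ⟨by rw [conjTranspose_smul, hX]; simp, by rw [trace_smul, hX', smul_zero]⟩

/-- The Lie bracket (commutator) of `𝔰𝔲(3)`. -/
def bracket (X Y : su3) : su3 :=
  ⟨(X : Matrix (Fin 3) (Fin 3) ℂ) * Y - Y * X, by
    obtain ⟨X, hX, _⟩ := X
    obtain ⟨Y, hY, _⟩ := Y
    have hX : Xᴴ = -X := hX
    have hY : Yᴴ = -Y := hY
    refine ⟨?_, ?_⟩
    · show (X * Y - Y * X)ᴴ = -(X * Y - Y * X)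
      rw [conjTranspose_sub, conjTranspose_mul, conjTranspose_mul, hX, hY]
      simp
    · show (X * Y - Y * X).trace = 0
      rw [trace_sub, trace_mul_comm, sub_self]⟩

theorem exp_mem_SU3 (X : su3) :
    NormedSpace.exp (X : Matrix (Fin 3) (Fin 3) ℂ) ∈ Matrix.specialUnitaryGroup (Fin 3) ℂ := by
  obtain ⟨X, hX, hX'⟩ := X
  have hX : Xᴴ = -X := hX
  have hX' : X.trace = 0 := hX'
  rw [mem_specialUnitaryGroup_iff]
  constructor
  · rw [mem_unitaryGroup_iff, star_eq_conjTranspose]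
    show NormedSpace.exp X * (NormedSpace.exp X)ᴴ = 1
    rw [← Matrix.exp_conjTranspose, hX,
      ← Matrix.exp_add_of_commute _ _ ((Commute.refl X).neg_right)]
    simp
  · -- diagonalise the Hermitian matrix `i X`
    have hH : (Complex.I • X).IsHermitian := by
      unfold Matrix.IsHermitian
      rw [conjTranspose_smul, hX]; simp
    have hs := hH.spectral_theorem
    rw [Unitary.conjStarAlgAut_apply] at hs
    set U : Matrix (Fin 3) (Fin 3) ℂ := (hH.eigenvectorUnitary : Matrix (Fin 3) (Fin 3) ℂ) with hU
    set D : Fin 3 → ℂ := fun i => (hH.eigenvalues i : ℂ) with hD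
    have hUU : U * star U = 1 := mem_unitaryGroup_iff.1 hH.eigenvectorUnitary.2
    have hUinv : U⁻¹ = star U := Matrix.inv_eq_right_inv hUU
    have hUunit : IsUnit U := (IsUnit.of_mul_eq_one _ hUU)
    have hXe : X = U * diagonal (-Complex.I • D) * U⁻¹ := by
      rw [hUinv, diagonal_smul, Matrix.mul_smul, Matrix.smul_mul]
      have : (RCLike.ofReal ∘ hH.eigenvalues : Fin 3 → ℂ) = D := rfl
      rw [this] at hs
      rw [← hs, smul_smul]; simp
    have htr : (∑ i, (-Complex.I • D) i) = 0 := by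
      rw [← trace_diagonal, ← hX', hXe, trace_mul_comm, ← Matrix.mul_assoc,
        Matrix.nonsing_inv_mul _ ((Matrix.isUnit_iff_isUnit_det _).1 hUunit), Matrix.one_mul]
    show (NormedSpace.exp X).det = 1
    rw [hXe, Matrix.exp_conj _ _ hUunit, Matrix.exp_diagonal, det_conj hUunit, det_diagonal]
    simp_rw [Pi.coe_exp, ← Complex.exp_eq_exp_ℂ]
    rw [← Complex.exp_sum, htr, Complex.exp_zero]

/-- The exponential map `𝔰𝔲(3) → SU(3)`. -/
def expSU (X : su3) : SU3 := ⟨NormedSpace.exp (X : Matrix (Fin 3) (Fin 3) ℂ), exp_mem_SU3 X⟩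

/-- The adjoint action `Ad_g X = g X g⁻¹` of `SU(3)` on `𝔰𝔲(3)`. -/
def Ad (g : SU3) (X : su3) : su3 :=
  ⟨(g : Matrix (Fin 3) (Fin 3) ℂ) * X * (g : Matrix (Fin 3) (Fin 3) ℂ)ᴴ, by
    obtain ⟨X, hX, hX'⟩ := X
    have hX : Xᴴ = -X := hX
    have hX' : X.trace = 0 := hX'
    have hg := (mem_unitaryGroup_iff'.1 (mem_specialUnitaryGroup_iff.1 g.2).1)
    rw [star_eq_conjTranspose] at hg
    refine ⟨?_, ?_⟩
    · show ((g : Matrix (Fin 3) (Fin 3) ℂ) * X * (g : Matrix (Fin 3) (Fin 3) ℂ)ᴴ)ᴴ = -(_ * X * _)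
      simp [conjTranspose_mul, hX, Matrix.mul_assoc]
    · show ((g : Matrix (Fin 3) (Fin 3) ℂ) * X * (g : Matrix (Fin 3) (Fin 3) ℂ)ᴴ).trace = 0
      rw [trace_mul_comm, ← Matrix.mul_assoc, hg, Matrix.one_mul, hX']⟩

instance : IsTopologicalGroup SU3 where
  continuous_inv := by
    refine Continuous.subtype_mk (f := fun g : SU3 => star (g : Matrix (Fin 3) (Fin 3) ℂ)) ?_ _
    exact continuous_star.comp continuous_subtype_val

instance : CompactSpace SU3 := by
  refine isCompact_iff_compactSpace.1
    (?_ : IsCompact (Matrix.specialUnitaryGroup (Fin 3) ℂ : Set (Matrix (Fin 3) (Fin 3) ℂ)))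
  have hK : IsCompact (Set.univ.pi fun _ : Fin 3 => Set.univ.pi fun _ : Fin 3 =>
      Metric.closedBall (0 : ℂ) 1) :=
    isCompact_univ_pi fun _ => isCompact_univ_pi fun _ => isCompact_closedBall _ _
  refine IsCompact.of_isClosed_subset (s := (Set.univ.pi fun _ : Fin 3 => Set.univ.pi
    fun _ : Fin 3 => Metric.closedBall (0 : ℂ) 1 : Set (Matrix (Fin 3) (Fin 3) ℂ))) hK ?_ ?_
  · have : (Matrix.specialUnitaryGroup (Fin 3) ℂ : Set (Matrix (Fin 3) (Fin 3) ℂ)) =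
        {A | A * star A = 1} ∩ {A | A.det = 1} := by
      ext A
      simp [mem_specialUnitaryGroup_iff, mem_unitaryGroup_iff]
    rw [this]
    exact (isClosed_eq (by fun_prop) continuous_const).inter
      (isClosed_eq (Continuous.matrix_det continuous_id) continuous_const)
  · intro A hA i _ j _
    simpa using entry_norm_bound_of_unitary (mem_specialUnitaryGroup_iff.1 hA).1 i j

instance : MeasurableSpace SU3 := borel SU3

instance : BorelSpace SU3 := ⟨rfl⟩

/-- The Haar probability measure of `SU(3)`. -/
def haarSU3 : Measure SU3 := Measure.haarMeasure ⊤

/-! ## Calculus on `SU(3)` in the left trivialisation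

The tangent space of `SU(3)` at `g` is identified with `𝔰𝔲(3)` through `X ↦ g X`. In this
trivialisation a form that is constant in `g` is a left-invariant form. -/

/-- A function on the closed submanifold `SU(3)` of the space of `3 × 3` matrices is smooth iff it
is the restriction of a smooth function on that space. -/
def IsSmooth (f : SU3 → ℂ) : Prop :=
  ∃ F : (Fin 3 → Fin 3 → ℂ) → ℂ, ContDiff ℝ ∞ F ∧
    ∀ g : SU3, f g = F (fun i j => (g : Matrix (Fin 3) (Fin 3) ℂ) i j)

/-- The derivative at `g` of a function along the left-invariant vector field of `X`. -/
def lieDeriv (X : su3) (f : SU3 → ℂ) (g : SU3) : ℂ :=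
  deriv (fun τ : ℝ => f (g * expSU (τ • X))) 0

/-- Complex valued 1-forms on `SU(3)`. -/
abbrev OneForm := SU3 → (su3 →ₗ[ℝ] ℂ)

/-- Complex valued covariant 2-tensors on `𝔰𝔲(3)`, given by their values. -/
abbrev TwoTensor := su3 → su3 → ℂ

/-- A 1-form is smooth iff its values on the left-invariant vector fields are. -/
def OneForm.IsSmooth (a : OneForm) : Prop := ∀ X : su3, FlagPHYM.IsSmooth fun g => a g X

/-- The exterior derivative of a 1-form, evaluated on left-invariant vector fields:
`(da)(X, Y) = X (a Y) - Y (a X) - a [X, Y]`. -/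
def extDeriv (a : OneForm) (g : SU3) : TwoTensor := fun X Y =>
  lieDeriv X (fun h => a h Y) g - lieDeriv Y (fun h => a h X) g - a g (bracket X Y)

/-- The wedge product of two 1-forms, `(a ∧ b)(X, Y) = a X * b Y - a Y * b X`. -/
def wedge (a b : su3 →ₗ[ℝ] ℂ) : TwoTensor := fun X Y => a X * b Y - a Y * b X

/-- The wedge product `F ∧ G ∧ H` of three 2-forms, evaluated on six vectors. -/
def wedge3 (F G H : TwoTensor) (v : Fin 6 → su3) : ℂ :=
  (1 / 8 : ℂ) * ∑ σ : Equiv.Perm (Fin 6), ((Equiv.Perm.sign σ : ℤ) : ℂ) *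
    (F (v (σ 0)) (v (σ 1)) * G (v (σ 2)) (v (σ 3)) * H (v (σ 4)) (v (σ 5)))

/-- Complex conjugation as a real linear map. -/
def conjForm (a : su3 →ₗ[ℝ] ℂ) : su3 →ₗ[ℝ] ℂ := Complex.conjAe.toLinearMap ∘ₗ a

/-! ## The Maurer-Cartan form -/

/-- The real linear form `X ↦ Re (X i j)`. -/
def reEntry (i j : Fin 3) : su3 →ₗ[ℝ] ℝ where
  toFun X := ((X : Matrix (Fin 3) (Fin 3) ℂ) i j).re
  map_add' X Y := by simp
  map_smul' c X := by simp

/-- The real linear form `X ↦ Im (X i j)`. -/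
def imEntry (i j : Fin 3) : su3 →ₗ[ℝ] ℝ where
  toFun X := ((X : Matrix (Fin 3) (Fin 3) ℂ) i j).im
  map_add' X Y := by simp
  map_smul' c X := by simp

/-- `θ₁, θ₂, θ₃` in
`g⁻¹dg = [[iβ₁, θ₃ + iη₃, -θ₂ + iη₂], [-θ₃ + iη₃, iβ₂, θ₁ + iη₁], [θ₂ + iη₂, -θ₁ + iη₁, iβ₃]]`. -/
def θ : Fin 3 → (su3 →ₗ[ℝ] ℝ) := ![reEntry 1 2, reEntry 2 0, reEntry 0 1]

/-- `η₁, η₂, η₃` in the Maurer-Cartan form. -/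
def η : Fin 3 → (su3 →ₗ[ℝ] ℝ) := ![imEntry 1 2, imEntry 2 0, imEntry 0 1]

/-- `β₁` in the Maurer-Cartan form. -/
def β₁ : su3 →ₗ[ℝ] ℝ := imEntry 0 0

/-- `β₂` in the Maurer-Cartan form. -/
def β₂ : su3 →ₗ[ℝ] ℝ := imEntry 1 1

/-! ## The flag manifold and its invariant almost Hermitian structures

The flag manifold is `𝔽₂ = SU(3) / T²` with `T² = exp 𝔱` the diagonal matrices. Forms on `𝔽₂` are
described by their pull-backs to `SU(3)`. -/

/-- The diagonal matrices in `𝔰𝔲(3)`, i.e. the Lie algebra `𝔱` of the maximal torus `T²`. -/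
def torusAlg : Submodule ℝ su3 where
  carrier := {X | (X : Matrix (Fin 3) (Fin 3) ℂ).IsDiag}
  add_mem' := fun hX hY => Matrix.IsDiag.add hX hY
  zero_mem' := Matrix.isDiag_zero
  smul_mem' := fun c _ hX => Matrix.IsDiag.smul c hX

/-- The data of an invariant almost Hermitian structure on `𝔽₂`: scales `A₁, A₂, A₃ > 0` and signs
`ε₁, ε₂, ε₃`. -/
structure InvariantAHS where
  A : Fin 3 → ℝ
  A_pos : ∀ j, 0 < A j
  ε : Fin 3 → ℝ
  ε_sign : ∀ j, ε j = 1 ∨ ε j = -1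

/-- The (1,0)-forms `α_j = A_j (η_j + i ε_j θ_j)`. -/
def InvariantAHS.α (S : InvariantAHS) (j : Fin 3) : su3 →ₗ[ℝ] ℂ where
  toFun X := S.A j * (η j X + Complex.I * S.ε j * θ j X)
  map_add' X Y := by simp only [map_add, Complex.ofReal_add]; ring
  map_smul' c X := by
    simp only [map_smul, smul_eq_mul, Complex.ofReal_mul, RingHom.id_apply, Complex.real_smul]
    ring

/-- The forms of type (1,0): the complex span of `α₁, α₂, α₃`. -/
def InvariantAHS.Λ10 (S : InvariantAHS) : Submodule ℂ (su3 →ₗ[ℝ] ℂ) :=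
  Submodule.span ℂ (Set.range S.α)

/-- The 2-forms of type (1,1): the complex span of the products `a ∧ b̄` with `a, b` of type
(1,0). -/
def InvariantAHS.Λ11 (S : InvariantAHS) : Submodule ℂ TwoTensor :=
  Submodule.span ℂ {F | ∃ a ∈ S.Λ10, ∃ b ∈ S.Λ10, F = wedge a (conjForm b)}

/-- The fundamental form `ω = (i/2) ∑ α_j ∧ ᾱ_j`. -/
def InvariantAHS.ω (S : InvariantAHS) : TwoTensor :=
  (Complex.I / 2) • ∑ j, wedge (S.α j) (conjForm (S.α j))

/-- The volume form `ω³ / 3!`. -/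
def InvariantAHS.volForm (S : InvariantAHS) (v : Fin 6 → su3) : ℂ :=
  (1 / 6 : ℂ) * wedge3 S.ω S.ω S.ω v

/-- The basis of the complement `𝔪` of `𝔱` (the off-diagonal matrices) dual to
`η₁, θ₁, η₂, θ₂, η₃, θ₃`. -/
def frame : Fin 6 → su3 :=
  ![⟨!![0, 0, 0; 0, 0, Complex.I; 0, Complex.I, 0], by
      refine ⟨?_, ?_⟩ <;> simp [Matrix.trace_fin_three, ← Matrix.ext_iff, Fin.forall_fin_succ]⟩,
    ⟨!![0, 0, 0; 0, 0, 1; 0, -1, 0], by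
      refine ⟨?_, ?_⟩ <;> simp [Matrix.trace_fin_three, ← Matrix.ext_iff, Fin.forall_fin_succ]⟩,
    ⟨!![0, 0, Complex.I; 0, 0, 0; Complex.I, 0, 0], by
      refine ⟨?_, ?_⟩ <;> simp [Matrix.trace_fin_three, ← Matrix.ext_iff, Fin.forall_fin_succ]⟩,
    ⟨!![0, 0, -1; 0, 0, 0; 1, 0, 0], by
      refine ⟨?_, ?_⟩ <;> simp [Matrix.trace_fin_three, ← Matrix.ext_iff, Fin.forall_fin_succ]⟩,
    ⟨!![0, Complex.I, 0; Complex.I, 0, 0; 0, 0, 0], by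
      refine ⟨?_, ?_⟩ <;> simp [Matrix.trace_fin_three, ← Matrix.ext_iff, Fin.forall_fin_succ]⟩,
    ⟨!![0, 1, 0; -1, 0, 0; 0, 0, 0], by
      refine ⟨?_, ?_⟩ <;> simp [Matrix.trace_fin_three, ← Matrix.ext_iff, Fin.forall_fin_succ]⟩]

/-- The Hodge star of a 6-form `ξ` on `𝔽₂`, i.e. the function `h` with `ξ = h · ω³ / 3!`. -/
def InvariantAHS.star (S : InvariantAHS) (ξ : (Fin 6 → su3) → ℂ) : ℂ :=
  ξ frame / S.volForm frame

/-- The Riemannian volume of `𝔽₂`. The forms `η₁, θ₁, η₂, θ₂, η₃, θ₃` define a metric of volume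
`π³ / 2`, and `ω³ / 3!` is `± (A₁ A₂ A₃)²` times its volume form. -/
def InvariantAHS.vol (S : InvariantAHS) : ℝ :=
  (S.A 0 * S.A 1 * S.A 2) ^ 2 * (Real.pi ^ 3 / 2)

/-- The integral over `𝔽₂`, oriented by `ω³`, of a 6-form `ξ` on `𝔽₂`, that is the integral of the
function `*ξ` for the Riemannian volume measure. The latter is the `SU(3)`-invariant measure of
total mass `vol`; in terms of functions on `SU(3)` it is `vol` times the Haar probability measure. -/
def InvariantAHS.integral (S : InvariantAHS) (ξ : SU3 → (Fin 6 → su3) → ℂ) : ℂ :=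
  S.vol * ∫ g, S.star (ξ g) ∂haarSU3

/-! ## The homogeneous line bundles and their connections -/

/-- An integral weight of `SU(3)`: a linear form `β` on `𝔱` for which
`e^{iβ} : T² → U(1)`, `exp X ↦ e^{iβ(X)}`, is well defined. -/
structure IntegralWeight where
  toLin : torusAlg →ₗ[ℝ] ℝ
  integral : ∀ X : torusAlg, expSU (X : su3) = 1 → ∃ n : ℤ, toLin X = 2 * Real.pi * n

/-- The value `e^{iβ(X)}` of the character `e^{iβ}` at `exp X`. -/
def IntegralWeight.char (β : IntegralWeight) (X : torusAlg) : ℂ :=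
  Complex.exp (Complex.I * β.toLin X)

/-- The smooth sections of `L_β = SU(3) ×_{(T², e^{iβ})} ℂ`: the smooth functions `s` on `SU(3)`
with `s(g t) = e^{iβ}(t)⁻¹ s(g)` for `t ∈ T²` (the section being `g T² ↦ [g, s(g)]`). -/
def IntegralWeight.IsSection (β : IntegralWeight) (s : SU3 → ℂ) : Prop :=
  IsSmooth s ∧ ∀ (g : SU3) (X : torusAlg), s (g * expSU (X : su3)) = (β.char X)⁻¹ * s g

/-- `φ` is (the pull-back to `SU(3)` of) a 1-form on `𝔽₂` with values in `L_β`: it is horizontal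
and equivariant. -/
def IntegralWeight.IsLForm (β : IntegralWeight) (φ : SU3 → su3 → ℂ) : Prop :=
  (∀ (g : SU3) (X : torusAlg), φ g X = 0) ∧
  ∀ (g : SU3) (X : torusAlg) (Y : su3),
    φ (g * expSU (X : su3)) (Ad (expSU (X : su3))⁻¹ Y) = (β.char X)⁻¹ * φ g Y

/-- The covariant derivative `∇s = ds + a s` of a section of `L_β`. -/
def covDeriv (a : OneForm) (s : SU3 → ℂ) : SU3 → su3 → ℂ := fun g Y =>
  lieDeriv Y s g + a g Y * s g

/-- A 1-form `a` on `SU(3)` is a (unitary) connection on `L_β`: it is smooth, has values in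
`𝔲(1) = iℝ`, and `∇s = ds + a s` takes the sections of `L_β` to 1-forms on `𝔽₂` with values in
`L_β`. -/
def IntegralWeight.IsConnection (β : IntegralWeight) (a : OneForm) : Prop :=
  a.IsSmooth ∧ (∀ g X, (a g X).re = 0) ∧ ∀ s, β.IsSection s → β.IsLForm (covDeriv a s)

/-- Invariance of a 1-form (hence of a connection) under the left action of `SU(3)`. -/
def IsInvariant (a : OneForm) : Prop := ∀ h g : SU3, a (h * g) = a g

/-- The projection `𝔰𝔲(3) = 𝔱 ⊕ 𝔪 → 𝔱` along the orthogonal complement `𝔪` of `𝔱` for the Killing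
form, i.e. the diagonal part. -/
def projTorus : su3 →ₗ[ℝ] torusAlg where
  toFun X := ⟨⟨diagonal fun i => (X : Matrix (Fin 3) (Fin 3) ℂ) i i, by
    obtain ⟨X, hX, hX'⟩ := X
    have hX : Xᴴ = -X := hX
    refine ⟨?_, ?_⟩
    · rw [diagonal_conjTranspose, diagonal_neg]
      congr 1
      funext i
      exact congrFun (congrFun hX i) i
    · rw [trace_diagonal]
      exact hX'⟩, isDiag_diagonal _⟩
  map_add' X Y := by
    apply Subtype.ext
    apply Subtype.ext
    exact (diagonal_add _ _).symm
  map_smul' c X := by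
    apply Subtype.ext
    apply Subtype.ext
    exact diagonal_smul c _

/-- The canonical connection `iβ` on `L_β`: the left-invariant 1-form on `SU(3)` that extends
`iβ : 𝔱 → iℝ` by zero on `𝔪`. -/
def IntegralWeight.canonical (β : IntegralWeight) : OneForm := fun _ =>
  { toFun := fun X => Complex.I * (β.toLin (projTorus X) : ℂ)
    map_add' := fun X Y => by simp [mul_add]
    map_smul' := fun c X => by simp; ring }

/-! ## Pseudo-holomorphic and pHYM connections, degree and slope -/

/-- The connection `a`, with curvature `F = da`, is pseudo-holomorphic: `F` is of type (1,1). -/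
def InvariantAHS.IsPseudoHolomorphic (S : InvariantAHS) (a : OneForm) : Prop :=
  ∀ g, extDeriv a g ∈ S.Λ11

/-- The contraction `ΛF = *(F ∧ ω²)` of a 2-form on `𝔽₂`. -/
def InvariantAHS.contract (S : InvariantAHS) (F : TwoTensor) : ℂ := S.star (wedge3 F S.ω S.ω)

/-- The connection `a` is pHYM of degree `c`: it is pseudo-holomorphic and `ΛF` is the constant
`c · i ∈ 𝔲(1)`. -/
def InvariantAHS.IsPHYM (S : InvariantAHS) (a : OneForm) (c : ℝ) : Prop :=
  S.IsPseudoHolomorphic a ∧ ∀ g, S.contract (extDeriv a g) = c * Complex.I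

/-- The number `2π ∫ c₁ ∧ ω²` for the representative `c₁ = (i / 2π) F` of the first Chern class
given by the connection `a`. -/
def InvariantAHS.chernWeil (S : InvariantAHS) (a : OneForm) : ℂ :=
  2 * Real.pi * S.integral fun g =>
    wedge3 ((Complex.I / (2 * Real.pi)) • extDeriv a g) S.ω S.ω

/-- The degree `deg(L_β) = 2π ⟨c₁(L_β) ∪ [ω²], [𝔽₂]⟩`, with `c₁(L_β) = (i / 2π) [d(iβ)]`. -/
def InvariantAHS.deg (S : InvariantAHS) (β : IntegralWeight) : ℝ := (S.chernWeil β.canonical).re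

/-- The slope `μ(L_β) = deg(L_β) / Vol(𝔽₂)`. -/
def InvariantAHS.slope (S : InvariantAHS) (β : IntegralWeight) : ℝ := S.deg β / S.vol

end

end FlagPHYM

namespace FlagPHYM

noncomputable section

/-! ## Top degree wedge products on the frame -/

/-! Uniqueness: for any connection `a`, horizontality of `∇s` forces `a = iβ` on `𝔱`, and
equivariance of `∇s` gives compatibility with `Ad` of the torus. If `a` is also left-invariant, it
is a single `Ad(T²)`-invariant linear form, which must vanish on `𝔪` because `𝔪` contains no trivial
weight (`IsConnection.eq_canonical`).

Curvature: `d(iβ)(X, Y) = -iβ([X, Y])` with `β` extended by zero on `𝔪`, and the diagonal of a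
bracket is a combination of the forms `η_j ∧ θ_j`. Each of these is a multiple of `α_j ∧ ᾱ_j`, hence
of type (1,1). With `w_j = A_j² ε_j` one has `ω = ∑ w_j η_j ∧ θ_j`, so contraction divides the
`j`-th coefficient by `w_j` (`contract_eq`). The result is the constant `-iμ`, which settles the
pHYM criterion; clearing denominators gives the condition on `k, l`.

Degree: `Λ(da)` only involves `da` on pairs of vectors in one root plane. Their bracket lies in `𝔱`,
where `a` is fixed by `β`, and the remaining derivative terms integrate to zero because Haar measure
is right-invariant (`integral_lieDeriv`). -/

/-- Reindexing by a transposition changes the sign, so an antisymmetrised factor may be replaced by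
twice one of its two terms. -/
theorem sum_sign_mul_sub_swap (h : Equiv.Perm (Fin 6) → ℂ) {i j : Fin 6} (hij : i ≠ j) :
    ∑ σ : Equiv.Perm (Fin 6), ((Equiv.Perm.sign σ : ℤ) : ℂ) * (h σ - h (σ * Equiv.swap i j)) =
      2 * ∑ σ : Equiv.Perm (Fin 6), ((Equiv.Perm.sign σ : ℤ) : ℂ) * h σ := by
  have key : ∑ σ : Equiv.Perm (Fin 6), ((Equiv.Perm.sign σ : ℤ) : ℂ) * h (σ * Equiv.swap i j) =
      -∑ σ : Equiv.Perm (Fin 6), ((Equiv.Perm.sign σ : ℤ) : ℂ) * h σ := by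
    rw [← Finset.sum_neg_distrib]
    refine Fintype.sum_equiv (Equiv.mulRight (Equiv.swap i j)) _ _ fun σ => ?_
    simp [Equiv.Perm.sign_mul, Equiv.Perm.sign_swap hij]
  simp only [mul_sub, Finset.sum_sub_distrib, key]
  ring

/-- The indicator function of the `j`-th of the pairs `(0, 1)`, `(2, 3)`, `(4, 5)`. -/
def pairIndicator (j : Fin 3) (a b : Fin 6) : ℂ :=
  if a.val = 2 * j.val ∧ b.val = 2 * j.val + 1 then 1 else 0

theorem sum_sign_mul_pairIndicator_self (F : Fin 6 → Fin 6 → ℂ) (j : Fin 3) :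
    ∑ σ : Equiv.Perm (Fin 6), ((Equiv.Perm.sign σ : ℤ) : ℂ) *
      (F (σ 0) (σ 1) * pairIndicator j (σ 2) (σ 3) * pairIndicator j (σ 4) (σ 5)) = 0 := by
  refine Finset.sum_eq_zero fun σ _ => ?_
  unfold pairIndicator
  split_ifs with h₁ h₂
  · have : σ 2 = σ 4 := Fin.ext (h₁.1.trans h₂.1.symm)
    exact absurd (σ.injective this) (by decide)
  all_goals simp

/-- The indicators prescribe `σ` at the last four places, so only `τ` and `τ * swap 0 1` survive,
with opposite signs. -/
theorem sum_sign_mul_pairIndicator (F : Fin 6 → Fin 6 → ℂ) (j k : Fin 3)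
    (τ : Equiv.Perm (Fin 6)) (hτ : Equiv.Perm.sign τ = 1)
    (h₂ : (τ 2).val = 2 * j.val) (h₃ : (τ 3).val = 2 * j.val + 1)
    (h₄ : (τ 4).val = 2 * k.val) (h₅ : (τ 5).val = 2 * k.val + 1) :
    ∑ σ : Equiv.Perm (Fin 6), ((Equiv.Perm.sign σ : ℤ) : ℂ) *
      (F (σ 0) (σ 1) * pairIndicator j (σ 2) (σ 3) * pairIndicator k (σ 4) (σ 5)) =
      F (τ 0) (τ 1) - F (τ 1) (τ 0) := by
  have aux : ∀ ρ : Equiv.Perm (Fin 6), ρ 2 = 2 → ρ 3 = 3 → ρ 4 = 4 → ρ 5 = 5 →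
      ρ = 1 ∨ ρ = Equiv.swap 0 1 := by decide +kernel
  have hne : τ ≠ τ * Equiv.swap 0 1 := by
    intro h
    have := congrArg (fun ρ : Equiv.Perm (Fin 6) => ρ 0) h
    simp at this
  have hs2 : Equiv.swap (0 : Fin 6) 1 2 = 2 := by decide
  have hs3 : Equiv.swap (0 : Fin 6) 1 3 = 3 := by decide
  have hs4 : Equiv.swap (0 : Fin 6) 1 4 = 4 := by decide
  have hs5 : Equiv.swap (0 : Fin 6) 1 5 = 5 := by decide
  have hsub : ∑ σ ∈ ({τ, τ * Equiv.swap 0 1} : Finset (Equiv.Perm (Fin 6))),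
      ((Equiv.Perm.sign σ : ℤ) : ℂ) *
        (F (σ 0) (σ 1) * pairIndicator j (σ 2) (σ 3) * pairIndicator k (σ 4) (σ 5)) =
      ∑ σ : Equiv.Perm (Fin 6), ((Equiv.Perm.sign σ : ℤ) : ℂ) *
        (F (σ 0) (σ 1) * pairIndicator j (σ 2) (σ 3) * pairIndicator k (σ 4) (σ 5)) := by
    refine Finset.sum_subset (Finset.subset_univ _) fun σ _ hσ => ?_
    unfold pairIndicator
    split_ifs with c₁ c₂
    · exfalso
      refine hσ ?_
      have e : ∀ i : Fin 6, (σ i).val = (τ i).val → (τ⁻¹ * σ) i = i := fun i hi => by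
        rw [Equiv.Perm.mul_apply, Fin.ext hi]; simp
      rcases aux (τ⁻¹ * σ) (e 2 (by rw [c₁.1, h₂])) (e 3 (by rw [c₁.2, h₃]))
        (e 4 (by rw [c₂.1, h₄])) (e 5 (by rw [c₂.2, h₅])) with h | h
      · simp [← inv_mul_eq_one.1 h]
      · simp [← h]
    all_goals simp
  rw [← hsub, Finset.sum_pair hne]
  simp [pairIndicator, Equiv.Perm.mul_apply, hs2, hs3, hs4, hs5, h₂, h₃, h₄, h₅, hτ]
  ring

/-- `F ∧ G ∧ G` on six vectors on which `G` is in normal form with coefficients `w`. -/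
theorem wedge3_normal_form (F G : TwoTensor) (v : Fin 6 → su3) (w : Fin 3 → ℂ)
    (hG : ∀ a b, G (v a) (v b) = ∑ j, w j * (pairIndicator j a b - pairIndicator j b a)) :
    wedge3 F G G v =
      (F (v 0) (v 1) - F (v 1) (v 0)) * w 1 * w 2 + (F (v 2) (v 3) - F (v 3) (v 2)) * w 0 * w 2 +
        (F (v 4) (v 5) - F (v 5) (v 4)) * w 0 * w 1 := by
  set f : Fin 6 → Fin 6 → ℂ := fun a b => F (v a) (v b) with hf
  have hs : ∀ j k : Fin 3, ∑ σ : Equiv.Perm (Fin 6), ((Equiv.Perm.sign σ : ℤ) : ℂ) *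
      (f (σ 0) (σ 1) * (pairIndicator j (σ 2) (σ 3) - pairIndicator j (σ 3) (σ 2)) *
        (pairIndicator k (σ 4) (σ 5) - pairIndicator k (σ 5) (σ 4))) =
      4 * ∑ σ : Equiv.Perm (Fin 6), ((Equiv.Perm.sign σ : ℤ) : ℂ) *
        (f (σ 0) (σ 1) * pairIndicator j (σ 2) (σ 3) * pairIndicator k (σ 4) (σ 5)) := by
    intro j k
    have h₁ := sum_sign_mul_sub_swap (fun σ => f (σ 0) (σ 1) * pairIndicator j (σ 2) (σ 3) *
        (pairIndicator k (σ 4) (σ 5) - pairIndicator k (σ 5) (σ 4)))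
        (show (2 : Fin 6) ≠ 3 by decide)
    have h₂ := sum_sign_mul_sub_swap (fun σ => f (σ 0) (σ 1) * pairIndicator j (σ 2) (σ 3) *
        pairIndicator k (σ 4) (σ 5)) (show (4 : Fin 6) ≠ 5 by decide)
    have s0 : Equiv.swap (2 : Fin 6) 3 0 = 0 := by decide
    have s1 : Equiv.swap (2 : Fin 6) 3 1 = 1 := by decide
    have s4 : Equiv.swap (2 : Fin 6) 3 4 = 4 := by decide
    have s5 : Equiv.swap (2 : Fin 6) 3 5 = 5 := by decide
    have t0 : Equiv.swap (4 : Fin 6) 5 0 = 0 := by decide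
    have t1 : Equiv.swap (4 : Fin 6) 5 1 = 1 := by decide
    have t2 : Equiv.swap (4 : Fin 6) 5 2 = 2 := by decide
    have t3 : Equiv.swap (4 : Fin 6) 5 3 = 3 := by decide
    simp only [Equiv.Perm.mul_apply, s0, s1, s4, s5, Equiv.swap_apply_left,
      Equiv.swap_apply_right] at h₁
    simp only [Equiv.Perm.mul_apply, t0, t1, t2, t3, Equiv.swap_apply_left,
      Equiv.swap_apply_right] at h₂
    rw [show (4 : ℂ) = 2 * 2 by norm_num, mul_assoc, ← h₂]
    simp only [← mul_sub] at h₁ ⊢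
    rw [← h₁]
    exact Finset.sum_congr rfl fun σ _ => by ring
  -- The factor `1 / 2` is the `1 / 8` of `wedge3` times the `4` of `hs`.
  have hexp : wedge3 F G G v = (1 / 2 : ℂ) * ∑ j, ∑ k, w j * w k *
      ∑ σ : Equiv.Perm (Fin 6), ((Equiv.Perm.sign σ : ℤ) : ℂ) *
        (f (σ 0) (σ 1) * pairIndicator j (σ 2) (σ 3) * pairIndicator k (σ 4) (σ 5)) := by
    have : ∀ j k : Fin 3, w j * w k *
        ∑ σ : Equiv.Perm (Fin 6), ((Equiv.Perm.sign σ : ℤ) : ℂ) *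
          (f (σ 0) (σ 1) * pairIndicator j (σ 2) (σ 3) * pairIndicator k (σ 4) (σ 5)) =
        (1 / 4 : ℂ) * ∑ σ : Equiv.Perm (Fin 6), w j * w k * (((Equiv.Perm.sign σ : ℤ) : ℂ) *
      (f (σ 0) (σ 1) * (pairIndicator j (σ 2) (σ 3) - pairIndicator j (σ 3) (σ 2)) *
        (pairIndicator k (σ 4) (σ 5) - pairIndicator k (σ 5) (σ 4)))) := by
      intro j k
      rw [← Finset.mul_sum, hs j k]; ring
    simp only [this, ← Finset.mul_sum, wedge3]
    rw [← mul_assoc]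
    norm_num only [one_div]
    congr 1
    simp only [Finset.mul_sum]
    rw [Finset.sum_congr rfl fun j _ => Finset.sum_comm, Finset.sum_comm]
    refine Finset.sum_congr rfl fun σ _ => ?_
    rw [hG, hG]
    simp only [Fin.sum_univ_three, hf]
    ring
  -- For each ordered pair `j ≠ k`, the permutation moves whole pairs, hence is even. The orders
  -- `(j, k)` and `(k, j)` contribute equally, which absorbs the `1 / 2`.
  have s01 := sum_sign_mul_pairIndicator f 0 1 ⟨![4, 5, 0, 1, 2, 3], ![2, 3, 4, 5, 0, 1],
    by decide, by decide⟩ (by decide) rfl rfl rfl rfl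
  have s10 := sum_sign_mul_pairIndicator f 1 0 ⟨![4, 5, 2, 3, 0, 1], ![4, 5, 2, 3, 0, 1],
    by decide, by decide⟩ (by decide) rfl rfl rfl rfl
  have s02 := sum_sign_mul_pairIndicator f 0 2 ⟨![2, 3, 0, 1, 4, 5], ![2, 3, 0, 1, 4, 5],
    by decide, by decide⟩ (by decide) rfl rfl rfl rfl
  have s20 := sum_sign_mul_pairIndicator f 2 0 ⟨![2, 3, 4, 5, 0, 1], ![4, 5, 0, 1, 2, 3],
    by decide, by decide⟩ (by decide) rfl rfl rfl rfl
  have s12 := sum_sign_mul_pairIndicator f 1 2 ⟨![0, 1, 2, 3, 4, 5], ![0, 1, 2, 3, 4, 5],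
    by decide, by decide⟩ (by decide) rfl rfl rfl rfl
  have s21 := sum_sign_mul_pairIndicator f 2 1 ⟨![0, 1, 4, 5, 2, 3], ![0, 1, 4, 5, 2, 3],
    by decide, by decide⟩ (by decide) rfl rfl rfl rfl
  rw [hexp]
  simp only [Fin.sum_univ_three, sum_sign_mul_pairIndicator_self, s01, s10, s02, s20, s12, s21]
  simp only [hf, Equiv.coe_fn_mk, Matrix.cons_val]
  ring

/-! ## The contraction `ΛF` -/

/-- The coefficient `A_j² ε_j` of `ω` on the `j`-th root plane. -/
def InvariantAHS.weight (S : InvariantAHS) (j : Fin 3) : ℂ := ((S.A j ^ 2 * S.ε j : ℝ) : ℂ)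

theorem InvariantAHS.weight_ne_zero (S : InvariantAHS) (j : Fin 3) : S.weight j ≠ 0 := by
  have h1 := (S.A_pos j).ne'
  have h2 : S.ε j ≠ 0 := by rcases S.ε_sign j with h | h <;> rw [h] <;> norm_num
  unfold InvariantAHS.weight
  exact_mod_cast mul_ne_zero (pow_ne_zero 2 h1) h2

theorem InvariantAHS.wedge_α (S : InvariantAHS) (j : Fin 3) (X Y : su3) :
    wedge (S.α j) (conjForm (S.α j)) X Y =
      -2 * Complex.I * S.weight j * (η j X * θ j Y - η j Y * θ j X) := by
  simp only [wedge, conjForm, InvariantAHS.α, InvariantAHS.weight, LinearMap.coe_comp,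
    Function.comp_apply, LinearMap.coe_mk, AddHom.coe_mk, AlgEquiv.toLinearMap_apply,
    Complex.conjAe_coe, map_mul, map_add, Complex.conj_ofReal, Complex.conj_I]
  push_cast
  ring

theorem InvariantAHS.ω_apply (S : InvariantAHS) (X Y : su3) :
    S.ω X Y = ∑ j, S.weight j * (η j X * θ j Y - η j Y * θ j X) := by
  simp only [InvariantAHS.ω, Pi.smul_apply, Finset.sum_apply, S.wedge_α, smul_eq_mul,
    Finset.mul_sum]
  refine Finset.sum_congr rfl fun j _ => ?_
  linear_combination (-(S.weight j * (η j X * θ j Y - η j Y * θ j X))) * Complex.I_sq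

theorem reEntry_apply (i j : Fin 3) (X : su3) :
    reEntry i j X = ((X : Matrix (Fin 3) (Fin 3) ℂ) i j).re := rfl

theorem imEntry_apply (i j : Fin 3) (X : su3) :
    imEntry i j X = ((X : Matrix (Fin 3) (Fin 3) ℂ) i j).im := rfl

theorem η_θ_frame (j : Fin 3) (a b : Fin 6) :
    (η j (frame a) * θ j (frame b) : ℂ) = pairIndicator j a b := by
  fin_cases j <;> fin_cases a <;> fin_cases b <;>
    simp [η, θ, frame, reEntry_apply, imEntry_apply, pairIndicator]

theorem InvariantAHS.ω_frame (S : InvariantAHS) (a b : Fin 6) : S.ω (frame a) (frame b) =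
    ∑ j, S.weight j * (pairIndicator j a b - pairIndicator j b a) := by
  simp only [S.ω_apply, η_θ_frame]

/-- The value is negative when `ε₁ε₂ε₃ = -1`: dividing by it in `star` is what builds in the
orientation by `ω³`. -/
theorem InvariantAHS.volForm_frame (S : InvariantAHS) :
    S.volForm frame = S.weight 0 * S.weight 1 * S.weight 2 := by
  rw [InvariantAHS.volForm, wedge3_normal_form _ _ _ _ S.ω_frame]
  simp only [S.ω_frame, Fin.sum_univ_three, pairIndicator]
  simp
  ring

/-- In `F ∧ ω²` the `j`-th plane carries the other two weights, so division by their triple product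
leaves `1 / w_j`. Differences appear because a `TwoTensor` need not be alternating. -/
theorem InvariantAHS.contract_eq (S : InvariantAHS) (F : TwoTensor) : S.contract F =
    (F (frame 0) (frame 1) - F (frame 1) (frame 0)) / S.weight 0 +
    (F (frame 2) (frame 3) - F (frame 3) (frame 2)) / S.weight 1 +
    (F (frame 4) (frame 5) - F (frame 5) (frame 4)) / S.weight 2 := by
  have h0 := S.weight_ne_zero 0
  have h1 := S.weight_ne_zero 1
  have h2 := S.weight_ne_zero 2
  rw [InvariantAHS.contract, InvariantAHS.star, S.volForm_frame,
    wedge3_normal_form _ _ _ _ S.ω_frame]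
  field_simp

/-! ## Calculus on `SU(3)` -/

/-- The matrix of an element of `SU(3)` as a point of the space on which smooth functions are
defined. -/
def entries (g : SU3) : Fin 3 → Fin 3 → ℂ := fun i j => (g : Matrix (Fin 3) (Fin 3) ℂ) i j

theorem continuous_entries : Continuous entries :=
  continuous_subtype_val

theorem expSU_zero : expSU 0 = 1 := by
  apply Subtype.ext
  simp [expSU]

section
-- Differentiating the exponential needs a normed algebra; the conclusion is stated entrywise, so
-- this choice of norm stays local.
attribute [local instance] Matrix.linftyOpNormedRing Matrix.linftyOpNormedAlgebra

theorem hasDerivAt_exp_smul_matrix (X : Matrix (Fin 3) (Fin 3) ℂ) (t : ℝ) :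
    HasDerivAt (fun u : ℝ => (fun i j => NormedSpace.exp (u • X) i j : Fin 3 → Fin 3 → ℂ))
      (fun i j => (NormedSpace.exp (t • X) * X) i j) t := by
  refine hasDerivAt_pi.2 fun i => hasDerivAt_pi.2 fun j => ?_
  have h := hasDerivAt_exp_smul_const (𝕂 := ℝ) X t
  exact (LinearMap.toContinuousLinearMap
    (Matrix.entryLinearMap ℝ ℂ i j)).hasFDerivAt.comp_hasDerivAt t h

end

theorem hasDerivAt_entries (g : SU3) (X : su3) (t : ℝ) :
    HasDerivAt (fun u : ℝ => entries (g * expSU (u • X)))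
      (fun i j => ((g * expSU (t • X) : SU3) * X : Matrix (Fin 3) (Fin 3) ℂ) i j) t := by
  have h := hasDerivAt_exp_smul_matrix X t
  refine hasDerivAt_pi.2 fun i => hasDerivAt_pi.2 fun j => ?_
  have h' := fun k : Fin 3 => (hasDerivAt_pi.1 (hasDerivAt_pi.1 h k) j).const_mul
    ((g : Matrix (Fin 3) (Fin 3) ℂ) i k)
  have hs := HasDerivAt.fun_sum (u := Finset.univ) fun k _ => h' k
  refine (hs.congr_deriv ?_)
  simp only [Submonoid.coe_mul, Matrix.mul_assoc]
  rfl

/-- A smooth function is differentiable along the flows of left-invariant vector fields, with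
derivative a continuous function on the group. -/
theorem IsSmooth.exists_hasDerivAt {f : SU3 → ℂ} (hf : IsSmooth f) (X : su3) :
    Continuous f ∧ Continuous (lieDeriv X f) ∧ ∀ (g : SU3) (t : ℝ),
      HasDerivAt (fun u : ℝ => f (g * expSU (u • X))) (lieDeriv X f (g * expSU (t • X))) t := by
  obtain ⟨F, hF, hfF⟩ := hf
  have hfe : f = fun g => F (entries g) := funext hfF
  let D : SU3 → ℂ := fun g =>
    fderiv ℝ F (entries g) (fun i j => ((g : Matrix (Fin 3) (Fin 3) ℂ) * X) i j)
  have hD : ∀ (g : SU3) (t : ℝ),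
      HasDerivAt (fun u : ℝ => f (g * expSU (u • X))) (D (g * expSU (t • X))) t := by
    intro g t
    rw [hfe]
    exact ((hF.differentiable (by simp)) _).hasFDerivAt.comp_hasDerivAt t
      (hasDerivAt_entries g X t)
  have hL : lieDeriv X f = D := by
    funext g
    have := (hD g 0).deriv
    rwa [zero_smul, expSU_zero, mul_one] at this
  refine ⟨hfe ▸ hF.continuous.comp continuous_entries, ?_, hL ▸ hD⟩
  rw [hL]
  refine ((hF.continuous_fderiv (by simp)).comp continuous_entries).clm_apply ?_
  have : Continuous fun g : SU3 => (g : Matrix (Fin 3) (Fin 3) ℂ) * X :=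
    continuous_subtype_val.matrix_mul continuous_const
  exact this

theorem IsSmooth.continuous_lieDeriv {f : SU3 → ℂ} (hf : IsSmooth f) (X : su3) :
    Continuous (lieDeriv X f) :=
  (hf.exists_hasDerivAt X).2.1

/-! ### Haar measure and integration by parts -/

instance : SecondCountableTopology SU3 :=
  haveI : SecondCountableTopology (Matrix (Fin 3) (Fin 3) ℂ) :=
    inferInstanceAs (SecondCountableTopology (Fin 3 → Fin 3 → ℂ))
  TopologicalSpace.Subtype.secondCountableTopology _

instance : Measure.IsHaarMeasure haarSU3 := by unfold haarSU3; infer_instance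

instance : IsProbabilityMeasure haarSU3 :=
  ⟨by
    simpa [haarSU3] using
      Measure.haarMeasure_self (K₀ := (⊤ : TopologicalSpace.PositiveCompacts SU3))⟩

/-- Unimodularity of a compact group: a right translate of Haar measure is again left-invariant,
hence proportional to it, and the total mass 1 fixes the constant. -/
instance : haarSU3.IsMulRightInvariant where
  map_mul_right_eq_self h := by
    have h₁ := Measure.haarMeasure_unique (haarSU3.map (· * h))
      (⊤ : TopologicalSpace.PositiveCompacts SU3)
    rwa [TopologicalSpace.PositiveCompacts.coe_top,
      Measure.map_apply (measurable_mul_const h) MeasurableSet.univ, Set.preimage_univ,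
      measure_univ, one_smul] at h₁

theorem integrable_of_continuous {f : SU3 → ℂ} (hf : Continuous f) : Integrable f haarSU3 :=
  hf.integrable_of_hasCompactSupport (HasCompactSupport.of_compactSpace f)

theorem integral_mul_right_haarSU3 (f : SU3 → ℂ) (h : SU3) :
    ∫ g, f (g * h) ∂haarSU3 = ∫ g, f g ∂haarSU3 := by
  exact integral_mul_right_eq_self f h

/-- Left-invariant vector fields are divergence free. -/
theorem IsSmooth.integral_lieDeriv {f : SU3 → ℂ} (hf : IsSmooth f) (X : su3) :
    ∫ g, lieDeriv X f g ∂haarSU3 = 0 := by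
  obtain ⟨hc, hc', hd⟩ := hf.exists_hasDerivAt X
  obtain ⟨C, hC⟩ := isCompact_univ.exists_bound_of_continuousOn hc'.continuousOn
  have hmul : ∀ h : SU3, Continuous fun g : SU3 => g * h := fun h => continuous_mul_const h
  -- Differentiate `∫ f(g exp(uX))` under the integral sign, with a constant bound by compactness.
  -- By right invariance this integral does not depend on `u`.
  have key := (hasDerivAt_integral_of_dominated_loc_of_deriv_le (μ := haarSU3)
    (F := fun (u : ℝ) g => f (g * expSU (u • X)))
    (F' := fun (u : ℝ) g => lieDeriv X f (g * expSU (u • X))) (x₀ := 0) (s := Set.univ)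
    (bound := fun _ => C) Filter.univ_mem
    (Filter.Eventually.of_forall fun u =>
      (integrable_of_continuous (hc.comp (hmul _))).aestronglyMeasurable)
    (integrable_of_continuous (hc.comp (hmul _)))
    (integrable_of_continuous (hc'.comp (hmul _))).aestronglyMeasurable
    (ae_of_all _ fun g u _ => hC _ (Set.mem_univ _)) (integrable_const C)
    (ae_of_all _ fun g u _ => hd g u)).2
  simp only [integral_mul_right_haarSU3, zero_smul, expSU_zero, mul_one] at key
  exact key.unique (hasDerivAt_const _ _)

/-! ## The maximal torus -/

theorem su3_ext {X Y : su3}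
    (h : ∀ i j, (X : Matrix (Fin 3) (Fin 3) ℂ) i j = (Y : Matrix (Fin 3) (Fin 3) ℂ) i j) : X = Y :=
  Subtype.ext (Matrix.ext h)

theorem su3_conj_apply (X : su3) (i j : Fin 3) :
    (starRingEnd ℂ) ((X : Matrix (Fin 3) (Fin 3) ℂ) j i) = -(X : Matrix (Fin 3) (Fin 3) ℂ) i j :=
  congrFun (congrFun X.2.1 i) j

theorem su3_apply_self (X : su3) (i : Fin 3) :
    (X : Matrix (Fin 3) (Fin 3) ℂ) i i =
      Complex.I * (((X : Matrix (Fin 3) (Fin 3) ℂ) i i).im : ℂ) := by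
  have h := congrArg Complex.re (su3_conj_apply X i i)
  rw [Complex.conj_re, Complex.neg_re] at h
  apply Complex.ext
  · simp; linarith
  · simp

theorem su3_trace_im (X : su3) : ((X : Matrix (Fin 3) (Fin 3) ℂ) 0 0).im +
    ((X : Matrix (Fin 3) (Fin 3) ℂ) 1 1).im + ((X : Matrix (Fin 3) (Fin 3) ℂ) 2 2).im = 0 := by
  have h := congrArg Complex.im X.2.2
  rwa [Matrix.trace_fin_three, Complex.add_im, Complex.add_im, Complex.zero_im] at h

theorem coe_torus_eq_diagonal (X : torusAlg) : ((X : su3) : Matrix (Fin 3) (Fin 3) ℂ) =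
    diagonal fun i => ((X : su3) : Matrix (Fin 3) (Fin 3) ℂ) i i :=
  (Matrix.IsDiag.diagonal_diag X.2).symm

theorem coe_expSU_torus (X : torusAlg) : (expSU (X : su3) : Matrix (Fin 3) (Fin 3) ℂ) =
    diagonal fun i => Complex.exp (((X : su3) : Matrix (Fin 3) (Fin 3) ℂ) i i) := by
  show NormedSpace.exp ((X : su3) : Matrix (Fin 3) (Fin 3) ℂ) = _
  conv_lhs => rw [coe_torus_eq_diagonal X]
  rw [Matrix.exp_diagonal]
  congr 1
  funext i
  rw [Pi.coe_exp, ← Complex.exp_eq_exp_ℂ]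

theorem projTorus_apply (X : su3) (i j : Fin 3) :
    ((projTorus X : su3) : Matrix (Fin 3) (Fin 3) ℂ) i j =
      if i = j then (X : Matrix (Fin 3) (Fin 3) ℂ) i i else 0 :=
  Matrix.diagonal_apply _ _ _

theorem projTorus_torus (X : torusAlg) : projTorus (X : su3) = X := by
  apply Subtype.ext
  apply Subtype.ext
  exact Matrix.IsDiag.diagonal_diag X.2

/-- The element `diag(ia, ib, -i(a + b))` of `𝔱`. -/
def torusElem (a b : ℝ) : torusAlg :=
  ⟨⟨diagonal ![Complex.I * a, Complex.I * b, -(Complex.I * a) - Complex.I * b], by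
    refine ⟨?_, ?_⟩
    · rw [diagonal_conjTranspose, diagonal_neg]
      congr 1
      funext i
      fin_cases i <;> simp [add_comm]
    · simp [Fin.sum_univ_three]⟩, isDiag_diagonal _⟩

theorem torusElem_apply (a b : ℝ) (i j : Fin 3) :
    ((torusElem a b : su3) : Matrix (Fin 3) (Fin 3) ℂ) i j =
      if i = j then ![Complex.I * a, Complex.I * b, -(Complex.I * a) - Complex.I * b] i else 0 :=
  Matrix.diagonal_apply _ _ _

theorem torus_eq_torusElem (X : torusAlg) : X = torusElem (β₁ X) (β₂ X) := by
  apply Subtype.ext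
  refine su3_ext fun i j => ?_
  rw [torusElem_apply]
  split_ifs with h
  · subst h
    rw [su3_apply_self]
    have := su3_trace_im (X : su3)
    fin_cases i <;> simp [β₁, β₂, imEntry_apply]
    rw [eq_neg_of_add_eq_zero_right this]
    push_cast
    ring
  · exact X.2 h

theorem torusElem_eq_smul_add (a b : ℝ) :
    torusElem a b = a • torusElem 1 0 + b • torusElem 0 1 := by
  apply Subtype.ext
  refine su3_ext fun i j => ?_
  simp only [Submodule.coe_add, Submodule.coe_smul, Matrix.add_apply, Matrix.smul_apply,
    torusElem_apply]
  split_ifs with h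
  · fin_cases i <;> simp <;> ring
  · simp

theorem expSU_torusElem_two_pi (m n : ℤ) :
    expSU (torusElem (2 * Real.pi * m) (2 * Real.pi * n) : su3) = 1 := by
  apply Subtype.ext
  rw [coe_expSU_torus]
  show _ = (1 : Matrix (Fin 3) (Fin 3) ℂ)
  rw [← diagonal_one]
  congr 1
  funext i
  rw [torusElem_apply, if_pos rfl, Complex.exp_eq_one_iff]
  fin_cases i
  · exact ⟨m, by simp; ring⟩
  · exact ⟨n, by simp; ring⟩
  · exact ⟨-m - n, by simp; ring⟩

/-- The weight lattice is spanned by `β₁` and `β₂`. -/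
theorem IntegralWeight.exists_eq (β : IntegralWeight) :
    ∃ k l : ℤ, ∀ X : torusAlg, β.toLin X = k * β₁ X + l * β₂ X := by
  -- Integrality is tested on two generators of the kernel of `exp` on `𝔱`.
  obtain ⟨k, hk⟩ := β.integral _ (expSU_torusElem_two_pi 1 0)
  obtain ⟨l, hl⟩ := β.integral _ (expSU_torusElem_two_pi 0 1)
  rw [torusElem_eq_smul_add] at hk hl
  have hpi := Real.pi_ne_zero
  have hk' : β.toLin (torusElem 1 0) = k := by
    simp only [map_add, map_smul, smul_eq_mul, Int.cast_one, Int.cast_zero, mul_one, mul_zero,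
      zero_mul, add_zero] at hk
    exact mul_left_cancel₀ (mul_ne_zero two_ne_zero hpi) hk
  have hl' : β.toLin (torusElem 0 1) = l := by
    simp only [map_add, map_smul, smul_eq_mul, Int.cast_one, Int.cast_zero, mul_one, mul_zero,
      zero_mul, zero_add] at hl
    exact mul_left_cancel₀ (mul_ne_zero two_ne_zero hpi) hl
  refine ⟨k, l, fun X => ?_⟩
  conv_lhs => rw [torus_eq_torusElem X, torusElem_eq_smul_add]
  rw [map_add, map_smul, map_smul, hk', hl', smul_eq_mul, smul_eq_mul]
  ring

/-! ## The adjoint action -/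

theorem coe_inv_SU3 (g : SU3) :
    ((g⁻¹ : SU3) : Matrix (Fin 3) (Fin 3) ℂ) = (g : Matrix (Fin 3) (Fin 3) ℂ)ᴴ := rfl

theorem expSU_Ad (h : SU3) (X : su3) : expSU (Ad h X) = h * expSU X * h⁻¹ := by
  apply Subtype.ext
  have hu : (h : Matrix (Fin 3) (Fin 3) ℂ) * (h : Matrix (Fin 3) (Fin 3) ℂ)ᴴ = 1 :=
    mem_unitaryGroup_iff.1 (mem_specialUnitaryGroup_iff.1 h.2).1
  have hinv := Matrix.inv_eq_right_inv hu
  show NormedSpace.exp ((h : Matrix (Fin 3) (Fin 3) ℂ) * X * (h : Matrix (Fin 3) (Fin 3) ℂ)ᴴ) =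
    (h : Matrix (Fin 3) (Fin 3) ℂ) * NormedSpace.exp (X : Matrix (Fin 3) (Fin 3) ℂ) *
      (h : Matrix (Fin 3) (Fin 3) ℂ)ᴴ
  rw [← hinv, Matrix.exp_conj _ _ (IsUnit.of_mul_eq_one _ hu)]

theorem Ad_smul (h : SU3) (c : ℝ) (X : su3) : Ad h (c • X) = c • Ad h X := by
  apply Subtype.ext
  show (h : Matrix (Fin 3) (Fin 3) ℂ) * (c • (X : Matrix (Fin 3) (Fin 3) ℂ)) * _ =
    c • ((h : Matrix (Fin 3) (Fin 3) ℂ) * X * _)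
  rw [Matrix.mul_smul, Matrix.smul_mul]

/-- This moves `t` to the far right, where the equivariance of a section applies. -/
theorem mul_expSU_Ad (g t : SU3) (Y : su3) (c : ℝ) :
    g * t * expSU (c • Ad t⁻¹ Y) = g * expSU (c • Y) * t := by
  rw [← Ad_smul, expSU_Ad]
  group

theorem Ad_inv_expSU_torus_apply (X : torusAlg) (Y : su3) (i j : Fin 3) :
    (Ad (expSU (X : su3))⁻¹ Y : Matrix (Fin 3) (Fin 3) ℂ) i j =
      Complex.exp (((X : su3) : Matrix (Fin 3) (Fin 3) ℂ) j j -
        ((X : su3) : Matrix (Fin 3) (Fin 3) ℂ) i i) * (Y : Matrix (Fin 3) (Fin 3) ℂ) i j := by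
  show (((expSU (X : su3))⁻¹ : SU3) * (Y : Matrix (Fin 3) (Fin 3) ℂ) *
    (((expSU (X : su3))⁻¹ : SU3) : Matrix (Fin 3) (Fin 3) ℂ)ᴴ) i j = _
  rw [coe_inv_SU3, conjTranspose_conjTranspose, coe_expSU_torus, diagonal_conjTranspose,
    mul_diagonal, diagonal_mul, Pi.star_apply, Complex.star_def, ← Complex.exp_conj,
    su3_conj_apply, Complex.exp_sub, Complex.exp_neg]
  ring

theorem projTorus_Ad_inv_expSU (X : torusAlg) (Y : su3) :
    projTorus (Ad (expSU (X : su3))⁻¹ Y) = projTorus Y := by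
  apply Subtype.ext
  refine su3_ext fun i j => ?_
  rw [projTorus_apply, projTorus_apply, Ad_inv_expSU_torus_apply, sub_self, Complex.exp_zero,
    one_mul]

/-- The projection to `𝔱` is the average of the adjoint action over the elements of order two of
the torus. -/
theorem projTorus_eq_average (Y : su3) : ((projTorus Y : torusAlg) : su3) = (1 / 4 : ℝ) • (Y +
    Ad (expSU (torusElem 0 Real.pi : su3))⁻¹ Y + Ad (expSU (torusElem Real.pi 0 : su3))⁻¹ Y +
    Ad (expSU (torusElem Real.pi (-Real.pi) : su3))⁻¹ Y) := by
  refine su3_ext fun i j => ?_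
  -- The three elements exponentiate to `diag(1,-1,-1)`, `diag(-1,1,-1)` and `diag(-1,-1,1)`. With
  -- the identity they form a Klein four-group, on which every root is a nontrivial sign character
  -- and so averages to zero.
  have e1 : Complex.exp (Complex.I * Real.pi) = -1 := by
    rw [mul_comm, Complex.exp_pi_mul_I]
  have e2 : Complex.exp (-(Complex.I * Real.pi)) = -1 := by
    rw [Complex.exp_neg, e1]; norm_num
  have e3 : Complex.exp (Complex.I * Real.pi + Complex.I * Real.pi) = 1 := by
    rw [Complex.exp_add, e1]; norm_num
  have e4 : Complex.exp (-(Complex.I * Real.pi) - Complex.I * Real.pi) = 1 := by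
    rw [Complex.exp_sub, e1, e2]; norm_num
  simp only [Submodule.coe_smul, Submodule.coe_add, Matrix.smul_apply, Matrix.add_apply,
    projTorus_apply, Ad_inv_expSU_torus_apply, torusElem_apply]
  fin_cases i <;> fin_cases j <;> simp [e1, e2, e3, e4] <;> ring

/-! ## Sections of `L_β` -/

theorem IsSmooth.mul {f f' : SU3 → ℂ} (hf : IsSmooth f) (hf' : IsSmooth f') :
    IsSmooth fun g => f g * f' g := by
  obtain ⟨F, hF, h⟩ := hf
  obtain ⟨F', hF', h'⟩ := hf'
  exact ⟨fun z => F z * F' z, hF.mul hF', fun g => congrArg₂ (· * ·) (h g) (h' g)⟩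

theorem isSmooth_const (c : ℂ) : IsSmooth fun _ => c :=
  ⟨fun _ => c, contDiff_const, fun _ => rfl⟩

theorem IsSmooth.comp_mul_left {f : SU3 → ℂ} (hf : IsSmooth f) (h : SU3) :
    IsSmooth fun g => f (h * g) := by
  obtain ⟨F, hF, hfF⟩ := hf
  refine ⟨fun z => F fun i j => ∑ k, (h : Matrix (Fin 3) (Fin 3) ℂ) i k * z k j,
    hF.comp ?_, fun g => hfF (h * g)⟩
  fun_prop

/-- The power `z̄ ^ k` for `k ≥ 0` and `z ^ (-k)` for `k ≤ 0`, of weight `-k` under rotation. -/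
def conjPow (k : ℤ) (z : ℂ) : ℂ := (starRingEnd ℂ z) ^ k.toNat * z ^ (-k).toNat

theorem conjPow_one (k : ℤ) : conjPow k 1 = 1 := by simp [conjPow]

theorem contDiff_conjPow (k : ℤ) : ContDiff ℝ ∞ (conjPow k) :=
  (Complex.conjCLE.contDiff.pow _).mul (contDiff_id.pow _)

theorem conjPow_mul_exp (k : ℤ) (z : ℂ) (x : ℝ) :
    conjPow k (z * Complex.exp (Complex.I * x)) =
      Complex.exp (-(Complex.I * (k * x))) * conjPow k z := by
  have hk : (k : ℂ) = (k.toNat : ℂ) - ((-k).toNat : ℂ) := by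
    have := Int.toNat_sub_toNat_neg k
    exact_mod_cast this.symm
  have he : Complex.exp (-(Complex.I * (k * x))) =
      Complex.exp (-(Complex.I * x)) ^ k.toNat * Complex.exp (Complex.I * x) ^ (-k).toNat := by
    rw [← Complex.exp_nat_mul, ← Complex.exp_nat_mul, ← Complex.exp_add, hk]
    congr 1
    ring
  have hc : (starRingEnd ℂ) (Complex.exp (Complex.I * x)) = Complex.exp (-(Complex.I * x)) := by
    rw [← Complex.exp_conj, map_mul, Complex.conj_I, Complex.conj_ofReal, neg_mul]
  rw [conjPow, conjPow, map_mul, hc, he]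
  ring

/-- The section `g ↦ conjPow k g₁₁ · conjPow l g₂₂` of the line bundle of `k β₁ + l β₂`. -/
theorem IntegralWeight.isSection_conjPow (β : IntegralWeight) {k l : ℤ}
    (h : ∀ X : torusAlg, β.toLin X = k * β₁ X + l * β₂ X) :
    β.IsSection fun g => conjPow k ((g : Matrix (Fin 3) (Fin 3) ℂ) 0 0) *
      conjPow l ((g : Matrix (Fin 3) (Fin 3) ℂ) 1 1) := by
  have hs : ∀ (k : ℤ) (i : Fin 3),
      IsSmooth fun g => conjPow k ((g : Matrix (Fin 3) (Fin 3) ℂ) i i) := fun k i =>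
    ⟨fun z => conjPow k (z i i), (contDiff_conjPow k).comp (by fun_prop), fun g => rfl⟩
  refine ⟨(hs k 0).mul (hs l 1), fun g X => ?_⟩
  have hd : ∀ i : Fin 3, ((g * expSU (X : su3) : SU3) : Matrix (Fin 3) (Fin 3) ℂ) i i =
      (g : Matrix (Fin 3) (Fin 3) ℂ) i i *
        Complex.exp (Complex.I * (((X : su3) : Matrix (Fin 3) (Fin 3) ℂ) i i).im) := by
    intro i
    rw [Submonoid.coe_mul, coe_expSU_torus, mul_diagonal]
    conv_lhs => rw [su3_apply_self]
  simp only [hd, conjPow_mul_exp]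
  rw [IntegralWeight.char, ← Complex.exp_neg, h]
  have : Complex.exp (-(Complex.I * ((k * β₁ X + l * β₂ X : ℝ) : ℂ))) =
      Complex.exp (-(Complex.I * (k * (((X : su3) : Matrix (Fin 3) (Fin 3) ℂ) 0 0).im))) *
      Complex.exp (-(Complex.I * (l * (((X : su3) : Matrix (Fin 3) (Fin 3) ℂ) 1 1).im))) := by
    rw [← Complex.exp_add]
    congr 1
    simp only [β₁, β₂, imEntry_apply]
    push_cast
    ring
  rw [this]
  ring

theorem IntegralWeight.IsSection.comp_mul_left {β : IntegralWeight} {s : SU3 → ℂ}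
    (hs : β.IsSection s) (h : SU3) : β.IsSection fun g => s (h * g) :=
  ⟨hs.1.comp_mul_left h, fun g X => by
    show s (h * (g * _)) = _
    rw [← mul_assoc, hs.2]⟩

/-- Left translation carries the explicit section, equal to 1 at the identity, to any point. This
allows `s g` to be cancelled when reading off `a` from `∇s`. -/
theorem IntegralWeight.exists_isSection_ne_zero (β : IntegralWeight) (g : SU3) :
    ∃ s, β.IsSection s ∧ s g ≠ 0 := by
  obtain ⟨k, l, h⟩ := β.exists_eq
  refine ⟨_, (β.isSection_conjPow h).comp_mul_left g⁻¹, ?_⟩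
  simp [conjPow_one]

theorem IntegralWeight.IsSection.lieDeriv_torus {β : IntegralWeight} {s : SU3 → ℂ}
    (hs : β.IsSection s) (X : torusAlg) (g : SU3) :
    lieDeriv X s g = -(Complex.I * β.toLin X) * s g := by
  have h : ∀ τ : ℝ, s (g * expSU (τ • (X : su3))) =
      Complex.exp (τ * -(Complex.I * β.toLin X)) * s g := by
    intro τ
    rw [← Submodule.coe_smul, hs.2, IntegralWeight.char, ← Complex.exp_neg, map_smul, smul_eq_mul]
    congr 2
    push_cast
    ring
  unfold lieDeriv
  simp only [h]
  have hd : HasDerivAt (fun τ : ℝ => Complex.exp (τ * -(Complex.I * β.toLin X)) * s g)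
      (-(Complex.I * β.toLin X) * s g) 0 := by
    have h1 : HasDerivAt (fun τ : ℝ => (τ : ℂ) * -(Complex.I * β.toLin X))
        (1 * -(Complex.I * β.toLin X)) 0 :=
      (Complex.ofRealCLM.hasDerivAt (x := (0 : ℝ))).mul_const _
    simpa using h1.cexp.mul_const (s g)
  exact hd.deriv

theorem IntegralWeight.IsSection.lieDeriv_Ad {β : IntegralWeight} {s : SU3 → ℂ}
    (hs : β.IsSection s) (X : torusAlg) (Y : su3) (g : SU3) :
    lieDeriv (Ad (expSU (X : su3))⁻¹ Y) s (g * expSU (X : su3)) =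
      (β.char X)⁻¹ * lieDeriv Y s g := by
  unfold lieDeriv
  simp only [mul_expSU_Ad, hs.2]
  exact deriv_const_mul_field _

theorem IntegralWeight.char_ne_zero (β : IntegralWeight) (X : torusAlg) : β.char X ≠ 0 :=
  Complex.exp_ne_zero _

/-! ## Connections on `L_β` -/

theorem IntegralWeight.canonical_apply (β : IntegralWeight) (g : SU3) (X : su3) :
    β.canonical g X = Complex.I * (β.toLin (projTorus X) : ℂ) := rfl

theorem IntegralWeight.isConnection_canonical (β : IntegralWeight) :
    β.IsConnection β.canonical := by
  refine ⟨fun X => isSmooth_const _, fun g X => by simp [β.canonical_apply],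
    fun s hs => ⟨fun g X => ?_, fun g X Y => ?_⟩⟩
  · rw [covDeriv, hs.lieDeriv_torus, β.canonical_apply, projTorus_torus]
    ring
  · rw [covDeriv, covDeriv, hs.lieDeriv_Ad, hs.2, β.canonical_apply, β.canonical_apply,
      projTorus_Ad_inv_expSU]
    ring

theorem IntegralWeight.IsConnection.apply_torus {β : IntegralWeight} {a : OneForm}
    (ha : β.IsConnection a) (g : SU3) (X : torusAlg) :
    a g X = Complex.I * (β.toLin X : ℂ) := by
  obtain ⟨s, hs, hne⟩ := β.exists_isSection_ne_zero g
  have h := (ha.2.2 s hs).1 g X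
  rw [covDeriv, hs.lieDeriv_torus, ← add_mul] at h
  linear_combination (mul_eq_zero.1 h).resolve_right hne

theorem IntegralWeight.IsConnection.apply_Ad {β : IntegralWeight} {a : OneForm}
    (ha : β.IsConnection a) (g : SU3) (X : torusAlg) (Y : su3) :
    a (g * expSU (X : su3)) (Ad (expSU (X : su3))⁻¹ Y) = a g Y := by
  obtain ⟨s, hs, hne⟩ := β.exists_isSection_ne_zero g
  have h := (ha.2.2 s hs).2 g X Y
  rw [covDeriv, covDeriv, hs.lieDeriv_Ad, hs.2] at h
  have hc := inv_ne_zero (β.char_ne_zero X)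
  refine mul_right_cancel₀ (mul_ne_zero hc hne) ?_
  linear_combination h

/-- Invariance makes `a` constant in `g`, so `a` agrees on `Y` and on its torus average `projTorus
Y`, where its value is known. -/
theorem IntegralWeight.IsConnection.eq_canonical {β : IntegralWeight} {a : OneForm}
    (ha : β.IsConnection a) (hinv : IsInvariant a) : a = β.canonical := by
  funext g
  refine LinearMap.ext fun Y => ?_
  have hconst : ∀ h : SU3, a h = a g := fun h => by
    rw [← hinv (g * h⁻¹) h, inv_mul_cancel_right]
  have hAd : ∀ X : torusAlg, a g (Ad (expSU (X : su3))⁻¹ Y) = a g Y := fun X => by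
    rw [← ha.apply_Ad g X Y, hconst (g * _)]
  have h := ha.apply_torus g (projTorus Y)
  rw [projTorus_eq_average, map_smul, map_add, map_add, map_add, hAd, hAd, hAd] at h
  rw [β.canonical_apply, ← h, Complex.real_smul]
  push_cast
  ring

/-! ## The curvature of the canonical connection -/

theorem lieDeriv_const (X : su3) (c : ℂ) (g : SU3) : lieDeriv X (fun _ => c) g = 0 := by
  simp [lieDeriv]

theorem IntegralWeight.extDeriv_canonical (β : IntegralWeight) (g : SU3) (X Y : su3) :
    extDeriv β.canonical g X Y = -(Complex.I * (β.toLin (projTorus (bracket X Y)) : ℂ)) := by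
  simp only [extDeriv, β.canonical_apply, lieDeriv_const]
  ring

/-- The value of `η_j ∧ θ_j`. -/
def rootForm (j : Fin 3) (X Y : su3) : ℝ := η j X * θ j Y - η j Y * θ j X

theorem su3_apply_lower (X : su3) (i j : Fin 3) :
    ((X : Matrix (Fin 3) (Fin 3) ℂ) j i).re = -((X : Matrix (Fin 3) (Fin 3) ℂ) i j).re ∧
    ((X : Matrix (Fin 3) (Fin 3) ℂ) j i).im = ((X : Matrix (Fin 3) (Fin 3) ℂ) i j).im := by
  have h := su3_conj_apply X i j
  have h1 := congrArg Complex.re h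
  have h2 := congrArg Complex.im h
  simp at h1 h2
  exact ⟨h1, h2⟩

/-- A diagonal entry of a commutator pairs entries `(i, j)` and `(j, i)`, so only the two root
planes meeting that index contribute. The cyclic sign convention for `θ` makes their signs opposite.
-/
theorem β₁_bracket (X Y : su3) : β₁ (bracket X Y) = 2 * (rootForm 1 X Y - rootForm 2 X Y) := by
  simp [β₁, imEntry_apply, bracket, Matrix.mul_apply, Fin.sum_univ_three, rootForm, η, θ,
    reEntry_apply, su3_apply_lower X 0 1, su3_apply_lower X 2 0, su3_apply_lower Y 0 1,
    su3_apply_lower Y 2 0]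
  ring

theorem β₂_bracket (X Y : su3) : β₂ (bracket X Y) = 2 * (rootForm 2 X Y - rootForm 0 X Y) := by
  simp [β₂, imEntry_apply, bracket, Matrix.mul_apply, Fin.sum_univ_three, rootForm, η, θ,
    reEntry_apply, su3_apply_lower X 0 1, su3_apply_lower X 1 2, su3_apply_lower Y 0 1,
    su3_apply_lower Y 1 2]
  ring

theorem β₁_projTorus (X : su3) : β₁ (projTorus X : su3) = β₁ X := by
  simp [β₁, imEntry_apply, projTorus_apply]

theorem β₂_projTorus (X : su3) : β₂ (projTorus X : su3) = β₂ X := by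
  simp [β₂, imEntry_apply, projTorus_apply]

theorem IntegralWeight.extDeriv_canonical_eq (β : IntegralWeight) {k l : ℤ}
    (h : ∀ X : torusAlg, β.toLin X = k * β₁ X + l * β₂ X) (g : SU3) (X Y : su3) :
    extDeriv β.canonical g X Y = 2 * Complex.I * (l * rootForm 0 X Y - k * rootForm 1 X Y +
      (k - l) * rootForm 2 X Y) := by
  rw [β.extDeriv_canonical, h, β₁_projTorus, β₂_projTorus, β₁_bracket, β₂_bracket]
  push_cast
  ring

theorem InvariantAHS.rootForm_mem_Λ11 (S : InvariantAHS) (j : Fin 3) (c : ℂ) :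
    (fun X Y => c * rootForm j X Y : TwoTensor) ∈ S.Λ11 := by
  have hα : S.α j ∈ S.Λ10 := Submodule.subset_span ⟨j, rfl⟩
  have hw : wedge (S.α j) (conjForm (S.α j)) ∈ S.Λ11 :=
    Submodule.subset_span ⟨_, hα, _, hα, rfl⟩
  convert S.Λ11.smul_mem (c / (-2 * Complex.I * S.weight j)) hw using 1
  funext X Y
  have h := S.weight_ne_zero j
  have hI := Complex.I_ne_zero
  rw [Pi.smul_apply, Pi.smul_apply, S.wedge_α, smul_eq_mul, rootForm]
  push_cast
  field_simp

theorem InvariantAHS.isPseudoHolomorphic_canonical (S : InvariantAHS) (β : IntegralWeight) :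
    S.IsPseudoHolomorphic β.canonical := by
  intro g
  obtain ⟨k, l, h⟩ := β.exists_eq
  have := S.Λ11.add_mem (S.Λ11.add_mem (S.rootForm_mem_Λ11 0 (2 * Complex.I * l))
    (S.rootForm_mem_Λ11 1 (-2 * Complex.I * k))) (S.rootForm_mem_Λ11 2 (2 * Complex.I * (k - l)))
  convert this using 1
  funext X Y
  simp only [Pi.add_apply, β.extDeriv_canonical_eq h]
  ring

theorem rootForm_frame (j : Fin 3) (a b : Fin 6) :
    (rootForm j (frame a) (frame b) : ℂ) = pairIndicator j a b - pairIndicator j b a := by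
  rw [← η_θ_frame, ← η_θ_frame, rootForm]
  push_cast
  rfl

theorem InvariantAHS.contract_canonical (S : InvariantAHS) (β : IntegralWeight) {k l : ℤ}
    (h : ∀ X : torusAlg, β.toLin X = k * β₁ X + l * β₂ X) (g : SU3) :
    S.contract (extDeriv β.canonical g) =
      4 * Complex.I * (l / S.weight 0 - k / S.weight 1 + (k - l) / S.weight 2) := by
  simp only [S.contract_eq, β.extDeriv_canonical_eq h, rootForm_frame, pairIndicator]
  simp
  ring

/-! ## The degree -/

/-- The `2π` of the degree cancels that of `c₁`, leaving only the factor `i`. -/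
theorem InvariantAHS.chernWeil_eq (S : InvariantAHS) (a : OneForm) :
    S.chernWeil a = S.vol * Complex.I * ∫ g, S.contract (extDeriv a g) ∂haarSU3 := by
  have h : ∀ g, S.star (wedge3 ((Complex.I / (2 * Real.pi)) • extDeriv a g) S.ω S.ω) =
      Complex.I / (2 * Real.pi) * S.contract (extDeriv a g) := by
    intro g
    change S.contract ((Complex.I / (2 * Real.pi)) • extDeriv a g) = _
    simp only [S.contract_eq, Pi.smul_apply, smul_eq_mul]
    ring
  have hpi : (Real.pi : ℂ) ≠ 0 := by exact_mod_cast Real.pi_ne_zero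
  simp only [InvariantAHS.chernWeil, InvariantAHS.integral, h, integral_const_mul]
  field_simp

/-- The derivative terms of `da` integrate to zero, and since `[X, Y]` is in `𝔱` the bracket term is
determined by `β` alone. -/
theorem IntegralWeight.IsConnection.integral_extDeriv {β : IntegralWeight} {a : OneForm}
    (ha : β.IsConnection a) {X Y : su3} (T : torusAlg) (hT : bracket X Y = T) (g₀ : SU3) :
    Integrable (fun g => extDeriv a g X Y) haarSU3 ∧
      ∫ g, extDeriv a g X Y ∂haarSU3 = extDeriv β.canonical g₀ X Y := by
  have hX := integrable_of_continuous ((ha.1 Y).continuous_lieDeriv X)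
  have hY := integrable_of_continuous ((ha.1 X).continuous_lieDeriv Y)
  have he : ∀ g, extDeriv a g X Y = lieDeriv X (fun h => a h Y) g - lieDeriv Y (fun h => a h X) g -
      Complex.I * (β.toLin T : ℂ) := fun g => by
    rw [extDeriv, hT, ha.apply_torus]
  simp only [he]
  have hXY : Integrable (fun g => lieDeriv X (fun h => a h Y) g - lieDeriv Y (fun h => a h X) g)
      haarSU3 := hX.sub hY
  refine ⟨hXY.sub (integrable_const _), ?_⟩
  rw [integral_sub hXY (integrable_const _), integral_sub hX hY,
    (ha.1 Y).integral_lieDeriv, (ha.1 X).integral_lieDeriv, integral_const,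
    β.extDeriv_canonical, hT, projTorus_torus]
  simp

/-- Equality of the halves says that both vectors lie in the same root plane. -/
theorem bracket_frame_mem_torusAlg (a b : Fin 6) (hab : a.val / 2 = b.val / 2) :
    bracket (frame a) (frame b) ∈ torusAlg := by
  intro i j hij
  simp only [bracket, Matrix.sub_apply, Matrix.mul_apply, Fin.sum_univ_three]
  fin_cases a <;> fin_cases b <;> first
    | (exfalso; revert hab; decide)
    | (fin_cases i <;> fin_cases j <;> simp [frame] at hij ⊢)

theorem IntegralWeight.IsConnection.integral_contract {β : IntegralWeight} {a : OneForm}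
    (ha : β.IsConnection a) (S : InvariantAHS) (g₀ : SU3) :
    ∫ g, S.contract (extDeriv a g) ∂haarSU3 = S.contract (extDeriv β.canonical g₀) := by
  have h := fun (p q : Fin 6) (hpq : p.val / 2 = q.val / 2) =>
    ha.integral_extDeriv ⟨_, bracket_frame_mem_torusAlg p q hpq⟩ rfl g₀
  have h' := fun (p q : Fin 6) (hpq : p.val / 2 = q.val / 2) (c : ℂ) =>
    show Integrable (fun g => (extDeriv a g (frame p) (frame q) -
      extDeriv a g (frame q) (frame p)) / c) haarSU3 from
    ((h p q hpq).1.sub (h q p hpq.symm).1).div_const c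
  have h'' := fun (p q : Fin 6) (hpq : p.val / 2 = q.val / 2) (c : ℂ) =>
    show ∫ g, (extDeriv a g (frame p) (frame q) - extDeriv a g (frame q) (frame p)) / c ∂haarSU3 =
      (extDeriv β.canonical g₀ (frame p) (frame q) -
        extDeriv β.canonical g₀ (frame q) (frame p)) / c by
    rw [integral_div, integral_sub (h p q hpq).1 (h q p hpq.symm).1, (h p q hpq).2,
      (h q p hpq.symm).2]
  simp only [S.contract_eq]
  have h₀ : Integrable (fun g => (extDeriv a g (frame 0) (frame 1) -
      extDeriv a g (frame 1) (frame 0)) / S.weight 0 + (extDeriv a g (frame 2) (frame 3) -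
      extDeriv a g (frame 3) (frame 2)) / S.weight 1) haarSU3 :=
    (h' 0 1 rfl _).add (h' 2 3 rfl _)
  rw [integral_add h₀ (h' 4 5 rfl _),
    integral_add (h' 0 1 rfl _) (h' 2 3 rfl _), h'' 0 1 rfl, h'' 2 3 rfl, h'' 4 5 rfl]

theorem IntegralWeight.IsConnection.chernWeil_eq {β : IntegralWeight} {a : OneForm}
    (ha : β.IsConnection a) (S : InvariantAHS) {k l : ℤ}
    (h : ∀ X : torusAlg, β.toLin X = k * β₁ X + l * β₂ X) :
    S.chernWeil a = ((-4 * S.vol * (l / (S.A 0 ^ 2 * S.ε 0) - k / (S.A 1 ^ 2 * S.ε 1) +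
      (k - l) / (S.A 2 ^ 2 * S.ε 2)) : ℝ) : ℂ) := by
  rw [S.chernWeil_eq, ha.integral_contract S 1, S.contract_canonical β h]
  simp only [InvariantAHS.weight]
  push_cast
  linear_combination (4 * S.vol * (l / (S.A 0 ^ 2 * S.ε 0) - k / (S.A 1 ^ 2 * S.ε 1) +
      (k - l) / (S.A 2 ^ 2 * S.ε 2)) : ℂ) * Complex.I_sq

/-! ### The slope and its vanishing -/

theorem InvariantAHS.vol_pos (S : InvariantAHS) : 0 < S.vol := by
  have := S.A_pos 0
  have := S.A_pos 1
  have := S.A_pos 2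
  have := Real.pi_pos
  unfold InvariantAHS.vol
  positivity

theorem InvariantAHS.slope_eq (S : InvariantAHS) (β : IntegralWeight) {k l : ℤ}
    (h : ∀ X : torusAlg, β.toLin X = k * β₁ X + l * β₂ X) :
    S.slope β = -4 * (l / (S.A 0 ^ 2 * S.ε 0) - k / (S.A 1 ^ 2 * S.ε 1) +
      (k - l) / (S.A 2 ^ 2 * S.ε 2)) := by
  have hv := S.vol_pos.ne'
  rw [InvariantAHS.slope, InvariantAHS.deg, β.isConnection_canonical.chernWeil_eq S h,
    Complex.ofReal_re]
  field_simp

/-- Homogeneity makes the contraction constant, so it equals its mean, which is the slope up to the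
factor `-i`. -/
theorem InvariantAHS.contract_canonical_eq_slope (S : InvariantAHS) (β : IntegralWeight)
    (g : SU3) : S.contract (extDeriv β.canonical g) = -Complex.I * S.slope β := by
  obtain ⟨k, l, h⟩ := β.exists_eq
  rw [S.contract_canonical β h, S.slope_eq β h]
  simp only [InvariantAHS.weight]
  push_cast
  ring

theorem InvariantAHS.isPHYM_canonical_zero_iff (S : InvariantAHS) (β : IntegralWeight) :
    S.IsPHYM β.canonical 0 ↔ S.slope β = 0 := by
  simp [InvariantAHS.IsPHYM, S.isPseudoHolomorphic_canonical β, S.contract_canonical_eq_slope β]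

theorem InvariantAHS.slope_eq_zero_iff (S : InvariantAHS) (β : IntegralWeight) {k l : ℤ}
    (h : ∀ X : torusAlg, β.toLin X = k * β₁ X + l * β₂ X) :
    S.slope β = 0 ↔
      k * S.ε 0 * S.A 0 ^ 2 * (S.A 1 ^ 2 * S.ε 1 - S.A 2 ^ 2 * S.ε 2) =
        l * S.ε 1 * S.A 1 ^ 2 * (S.A 0 ^ 2 * S.ε 0 - S.A 2 ^ 2 * S.ε 2) := by
  have hA := fun j => (S.A_pos j).ne'
  have hε : ∀ j, S.ε j ≠ 0 := fun j => by
    rcases S.ε_sign j with h | h <;> rw [h] <;> norm_num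
  have hA0 := hA 0
  have hA1 := hA 1
  have hA2 := hA 2
  have he0 := hε 0
  have he1 := hε 1
  have he2 := hε 2
  -- Multiplying by the nonzero product of the three weights clears the denominators; collecting the
  -- terms in `k` and in `l` gives the two sides.
  have key : S.slope β * (S.A 0 ^ 2 * S.ε 0 * (S.A 1 ^ 2 * S.ε 1) * (S.A 2 ^ 2 * S.ε 2)) =
      4 * (l * S.ε 1 * S.A 1 ^ 2 * (S.A 0 ^ 2 * S.ε 0 - S.A 2 ^ 2 * S.ε 2) -
        k * S.ε 0 * S.A 0 ^ 2 * (S.A 1 ^ 2 * S.ε 1 - S.A 2 ^ 2 * S.ε 2)) := by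
    rw [S.slope_eq β h]
    field_simp
    ring
  have hne : S.A 0 ^ 2 * S.ε 0 * (S.A 1 ^ 2 * S.ε 1) * (S.A 2 ^ 2 * S.ε 2) ≠ 0 := by
    positivity
  constructor
  · intro h0
    rw [h0, zero_mul] at key
    linarith
  · intro h0
    rw [h0, sub_self, mul_zero] at key
    exact (mul_eq_zero.1 key).resolve_right hne

end

end FlagPHYM

open FlagPHYM in
theorem proposition6 (S : InvariantAHS) (β : IntegralWeight) :
    -- `iβ` is a connection on `L_β`, and it is the unique invariant one
    (β.IsConnection β.canonical ∧ IsInvariant β.canonical ∧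
      ∀ a : OneForm, β.IsConnection a → IsInvariant a → a = β.canonical) ∧
    -- it is pseudo-holomorphic
    S.IsPseudoHolomorphic β.canonical ∧
    -- every connection on `L_β` computes the degree of `L_β`
    (∀ a : OneForm, β.IsConnection a → S.chernWeil a = S.deg β) ∧
    -- it is pHYM of degree 0 iff the slope of `L_β` vanishes
    (S.IsPHYM β.canonical 0 ↔ S.slope β = 0) ∧
    -- the explicit form of this condition
    (∀ k l : ℤ, (∀ X : torusAlg, β.toLin X = k * β₁ X + l * β₂ X) →
      (S.slope β = 0 ↔
        k * S.ε 0 * S.A 0 ^ 2 * (S.A 1 ^ 2 * S.ε 1 - S.A 2 ^ 2 * S.ε 2) =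
          l * S.ε 1 * S.A 1 ^ 2 * (S.A 0 ^ 2 * S.ε 0 - S.A 2 ^ 2 * S.ε 2))) := by
  refine ⟨⟨β.isConnection_canonical, fun _ _ => rfl, fun _ ha hinv => ha.eq_canonical hinv⟩,
    S.isPseudoHolomorphic_canonical β, fun a ha => ?_, S.isPHYM_canonical_zero_iff β,
    fun k l h => S.slope_eq_zero_iff β h⟩
  -- Both sides equal the same real expression in `k, l`, so taking the real part in `deg` loses
  -- nothing.
  obtain ⟨k, l, h⟩ := β.exists_eq
  rw [InvariantAHS.deg, ha.chernWeil_eq S h, β.isConnection_canonical.chernWeil_eq S h,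
    Complex.ofReal_re]
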